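/- Let $P_1,P_2,Q\ge 0$. Consider the state-dependent Gaussian multiple-access channel $Y_i=X_{1,i}+X_{2,i}+S_i+Z_i$, $i=1,\dots,n$, where $S_1,\dots,S_n$ are i.i.d. $\mathcal N(0,Q)$ (the state), $Z_1,\dots,Z_n$ are i.i.d. $\mathcal N(0,1)$ (the noise), and the state, the noise and the messages $M_1,M_2$ are independent, with $M_1$ and $M_2$ uniformly distributed on finite sets. Encoder 1 knows the whole state sequence in advance and sends $X_1^n=x_1^n(M_1,S^n)$; encoder 2 does not know the state and sends $X_2^n=x_2^n(M_2)$; they satisfy the average power constraints $\sum_{i=1}^n\mathbb E[X_{1,i}^2]\le nP_1$ and $\sum_{i=1}^n\mathbb E[X_{2,i}^2]\le nP_2$. The decoder estimates $(M_1,M_2)$ from $Y^n$ alone, and the error probability is $\mathbb P[(\hat M_1,\hat M_2)\ne(M_1,M_2)]$. Let logarithms be taken to an arbitrary fixed base $b>1$. A pair $(R_1,R_2)$ of nonnegative reals is achievable if there is a sequence of such codes, one for each blocklength $n$, with at least $b^{nR_1}$ and $b^{nR_2}$ messages respectively, whose error probability tends to $0$ as $n\to\infty$. The capacity region $\mathcal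 C(P_1,P_2,Q)$ (without degraded message sets) is the closure of the set of achievable pairs. Theorem. For every $(R_1,R_2)\in\mathcal C(P_1,P_2,Q)$ there is a $\rho\in[-1,0]$ such that $$R_1\le\tfrac12\log\bigl(1+P_1(1-\rho^2)\bigr),\qquad R_2\le\tfrac12\log(1+P_2),$$ $$R_1+R_2\le\tfrac12\log\Bigl(1+\frac{P_2}{1+P_1+Q+2\rho\sqrt{P_1Q}}\Bigr)+\tfrac12\log\bigl(1+P_1(1-\rho^2)\bigr).$$ -/

import Mathlib

open MeasureTheory ProbabilityTheory Filter Topology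
open scoped NNReal ENNReal

noncomputable section

/-- A block code of length `n` with message sets of sizes `k₁` and `k₂`: encoder 1 sees its message
and the whole state sequence, encoder 2 sees only its message, and the decoder sees only the
channel output. -/
structure DirtyMACCode (n k₁ k₂ : ℕ) where
  /-- the codeword `x₁ⁿ(m₁, sⁿ)` -/
  enc₁ : Fin k₁ → (Fin n → ℝ) → (Fin n → ℝ)
  measurable_enc₁ : ∀ m, Measurable (enc₁ m)
  /-- the codeword `x₂ⁿ(m₂)` -/
  enc₂ : Fin k₂ → (Fin n → ℝ)
  dec : (Fin n → ℝ) → Fin k₁ × Fin k₂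
  measurable_dec : Measurable dec

/-- Outcomes `(m₁, m₂, sⁿ, zⁿ)`: the two messages, the state sequence and the noise sequence. -/
abbrev DirtyMACOutcome (n k₁ k₂ : ℕ) : Type :=
  Fin k₁ × Fin k₂ × (Fin n → ℝ) × (Fin n → ℝ)

/-- The joint law of messages, state and noise: all independent, the messages uniform, the state
i.i.d. `N(0, Q)` and the noise i.i.d. `N(0, 1)`. -/
def dirtyMACLaw (n k₁ k₂ : ℕ) (Q : ℝ≥0) : Measure (DirtyMACOutcome n k₁ k₂) :=
  (uniformOn (Set.univ : Set (Fin k₁))).prod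
    ((uniformOn (Set.univ : Set (Fin k₂))).prod
      ((Measure.pi fun _ : Fin n => gaussianReal 0 Q).prod
        (Measure.pi fun _ : Fin n => gaussianReal 0 1)))

namespace DirtyMACCode

variable {n k₁ k₂ : ℕ} (c : DirtyMACCode n k₁ k₂)

/-- The input `X₁ⁿ = x₁ⁿ(M₁, Sⁿ)` of the state-cognitive user. -/
def X₁ (ω : DirtyMACOutcome n k₁ k₂) : Fin n → ℝ := c.enc₁ ω.1 ω.2.2.1

/-- The input `X₂ⁿ = x₂ⁿ(M₂)` of the non-cognitive user. -/
def X₂ (ω : DirtyMACOutcome n k₁ k₂) : Fin n → ℝ := c.enc₂ ω.2.1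

/-- The channel output `Yⁿ = X₁ⁿ + X₂ⁿ + Sⁿ + Zⁿ`. -/
def Y (ω : DirtyMACOutcome n k₁ k₂) : Fin n → ℝ := c.X₁ ω + c.X₂ ω + ω.2.2.1 + ω.2.2.2

/-- The average power constraints `∑ᵢ E[X₁ᵢ²] ≤ n P₁` and `∑ᵢ E[X₂ᵢ²] ≤ n P₂`; the expectations are
Lebesgue integrals of nonnegative functions, so a non-integrable square violates them. -/
def SatisfiesPower (P₁ P₂ Q : ℝ≥0) : Prop :=
  ∑ i, ∫⁻ ω, ENNReal.ofReal (c.X₁ ω i ^ 2) ∂(dirtyMACLaw n k₁ k₂ Q) ≤ (n : ℝ≥0∞) * P₁ ∧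
  ∑ i, ∫⁻ ω, ENNReal.ofReal (c.X₂ ω i ^ 2) ∂(dirtyMACLaw n k₁ k₂ Q) ≤ (n : ℝ≥0∞) * P₂

/-- The average probability of error `P[(M̂₁, M̂₂) ≠ (M₁, M₂)]`. -/
def errorProb (Q : ℝ≥0) : ℝ :=
  (dirtyMACLaw n k₁ k₂ Q).real {ω | c.dec (c.Y ω) ≠ (ω.1, ω.2.1)}

end DirtyMACCode

/-- Rate pairs (logarithms to base `b`) for which there is a sequence of codes, one for each
blocklength `n`, with at least `b ^ (n R₁)` and `b ^ (n R₂)` messages, satisfying the power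
constraints, with vanishing average probability of error. -/
def DirtyMACAchievable (b : ℝ) (P₁ P₂ Q : ℝ≥0) (R : ℝ × ℝ) : Prop :=
  0 ≤ R.1 ∧ 0 ≤ R.2 ∧
    ∃ (k₁ k₂ : ℕ → ℕ) (c : ∀ n, DirtyMACCode n (k₁ n) (k₂ n)),
      (∀ n : ℕ, b ^ ((n : ℝ) * R.1) ≤ (k₁ n : ℝ) ∧ b ^ ((n : ℝ) * R.2) ≤ (k₂ n : ℝ) ∧
        (c n).SatisfiesPower P₁ P₂ Q) ∧
      Tendsto (fun n => (c n).errorProb Q) atTop (𝓝 0)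

/-- The capacity region of the dirty MAC without degraded message sets: the closure of the set of
achievable rate pairs. -/
def dirtyMACCapacityRegion (b : ℝ) (P₁ P₂ Q : ℝ≥0) : Set (ℝ × ℝ) :=
  closure {R | DirtyMACAchievable b P₁ P₂ Q R}

end

/-!
Each rate bound is a change of measure. Reweight the outcomes by `exp (-L)`, where `L` is a Gaussian
log-likelihood ratio chosen so that, under the new law, the vector from which the decoder works is
independent of the messages; a guess among `K` of them then succeeds with probability at most
`1 / K`, and Jensen's inequality gives `P(correct) * log K ≤ E[L] + log 2`. Second moments bound
`E[L]`. For the first user the decoder is granted the state and the other message, and the linear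
estimate of `X₁` from the state is subtracted first. For the sum rate, the output is made
independent of the messages and the state, and then the state is itself resampled given the
messages and the output: its estimation error has variance smaller than `Q` by the factor
`(1 + P₁ (1 - ρ²)) / (1 + P₁ + Q + 2 ρ √(P₁ Q))`, which is what the second reweighting gains.
-/

section ChangeOfMeasure

variable {Ω Ω' α β : Type*} [MeasurableSpace Ω] [MeasurableSpace Ω'] [MeasurableSpace α]
  [MeasurableSpace β] {μ : Measure Ω} {ν : Measure α} {ρ : Measure β}

/-- `IsReweighting T L μ ν` says that `T` has law `ν` once `μ` is reweighted by `exp (-L)`. For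
injective `T` this makes `L` the log-likelihood ratio of `μ` against the pullback of `ν`, so that
`∫ L ∂μ` is a relative entropy. -/
structure IsReweighting (T : Ω → α) (L : Ω → ℝ) (μ : Measure Ω) (ν : Measure α) : Prop where
  measurable : Measurable T
  measurable_logRatio : Measurable L
  lintegral_comp : ∀ f : α → ℝ≥0∞, Measurable f →
    ∫⁻ ω, ENNReal.ofReal (Real.exp (-L ω)) * f (T ω) ∂μ = ∫⁻ a, f a ∂ν

namespace IsReweighting

variable {T : Ω → α} {L : Ω → ℝ}

theorem of_map_withDensity_eq (hT : Measurable T) (hL : Measurable L)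
    (h : (μ.withDensity fun ω => ENNReal.ofReal (Real.exp (-L ω))).map T = ν) :
    IsReweighting T L μ ν where
  measurable := hT
  measurable_logRatio := hL
  lintegral_comp f hf := by
    rw [← h, lintegral_map hf hT]
    exact (lintegral_withDensity_eq_lintegral_mul _ hL.neg.exp.ennreal_ofReal (hf.comp hT)).symm

theorem comp {T' : α → β} {L' : α → ℝ} (h' : IsReweighting T' L' ν ρ)
    (h : IsReweighting T L μ ν) :
    IsReweighting (T' ∘ T) (fun ω => L ω + L' (T ω)) μ ρ where
  measurable := h'.measurable.comp h.measurable
  measurable_logRatio := h.measurable_logRatio.add (h'.measurable_logRatio.comp h.measurable)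
  lintegral_comp f hf := by
    have hm : Measurable fun a => ENNReal.ofReal (Real.exp (-L' a)) * f (T' a) :=
      h'.measurable_logRatio.neg.exp.ennreal_ofReal.mul (hf.comp h'.measurable)
    rw [← h'.lintegral_comp f hf, ← h.lintegral_comp _ hm]
    refine lintegral_congr fun ω => ?_
    rw [neg_add, Real.exp_add, ENNReal.ofReal_mul (Real.exp_pos _).le, mul_assoc,
      Function.comp_apply]

theorem comp_measurePreserving {ψ : Ω' → Ω} {μ' : Measure Ω'} (h : IsReweighting T L μ ν)
    (hψ : MeasurePreserving ψ μ' μ) : IsReweighting (T ∘ ψ) (L ∘ ψ) μ' ν where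
  measurable := h.measurable.comp hψ.measurable
  measurable_logRatio := h.measurable_logRatio.comp hψ.measurable
  lintegral_comp f hf := by
    have hm : Measurable fun ω => ENNReal.ofReal (Real.exp (-L ω)) * f (T ω) :=
      h.measurable_logRatio.neg.exp.ennreal_ofReal.mul (hf.comp h.measurable)
    rw [← h.lintegral_comp f hf, ← hψ.lintegral_comp hm]
    rfl

theorem measurePreserving_comp {φ : α → β} (hφ : MeasurePreserving φ ν ρ)
    (h : IsReweighting T L μ ν) : IsReweighting (φ ∘ T) L μ ρ where
  measurable := hφ.measurable.comp h.measurable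
  measurable_logRatio := h.measurable_logRatio
  lintegral_comp f hf := by
    rw [← hφ.lintegral_comp hf]
    exact h.lintegral_comp _ (hf.comp hφ.measurable)

theorem skewProduct [SFinite ν] [SFinite μ] {ξ : Measure Ω'} {T : Ω' → Ω → α}
    {L : Ω' → Ω → ℝ} (hT : Measurable (Function.uncurry T)) (hL : Measurable (Function.uncurry L))
    (h : ∀ a, IsReweighting (T a) (L a) μ ν) :
    IsReweighting (fun p : Ω' × Ω => (p.1, T p.1 p.2)) (Function.uncurry L) (ξ.prod μ)
      (ξ.prod ν) where
  measurable := measurable_fst.prodMk hT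
  measurable_logRatio := hL
  lintegral_comp f hf := by
    have hm : Measurable fun p : Ω' × Ω =>
        ENNReal.ofReal (Real.exp (-Function.uncurry L p)) * f (p.1, T p.1 p.2) :=
      hL.neg.exp.ennreal_ofReal.mul (hf.comp (measurable_fst.prodMk hT))
    rw [lintegral_prod _ hf.aemeasurable, lintegral_prod _ hm.aemeasurable]
    exact lintegral_congr fun a => (h a).lintegral_comp _ (hf.comp measurable_prodMk_left)

theorem pi {ι : Type*} [Fintype ι] {X Y : ι → Type*} [∀ i, MeasurableSpace (X i)]
    [∀ i, MeasurableSpace (Y i)] {μ : ∀ i, Measure (X i)} {ν : ∀ i, Measure (Y i)}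
    [∀ i, IsProbabilityMeasure (μ i)] [∀ i, SigmaFinite (ν i)] {T : ∀ i, X i → Y i}
    {L : ∀ i, X i → ℝ} (h : ∀ i, IsReweighting (T i) (L i) (μ i) (ν i)) :
    IsReweighting (fun x i => T i (x i)) (fun x => ∑ i, L i (x i)) (Measure.pi μ)
      (Measure.pi ν) := by
  have hT : ∀ i, Measurable (T i) := fun i => (h i).measurable
  have hL : ∀ i, Measurable (L i) := fun i => (h i).measurable_logRatio
  refine of_map_withDensity_eq (by fun_prop) (by fun_prop) (Measure.pi_eq fun s hs => ?_).symm
  set g : ∀ i, X i → ℝ≥0∞ := fun i x =>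
    ENNReal.ofReal (Real.exp (-L i x)) * (s i).indicator 1 (T i x) with hg
  have hgm : ∀ i, Measurable (g i) := fun i =>
    (hL i).neg.exp.ennreal_ofReal.mul ((measurable_one.indicator (hs i)).comp (hT i))
  have hfactor : ∀ i, ∫⁻ x, g i x ∂(μ i) = ν i (s i) := fun i => by
    rw [(h i).lintegral_comp _ (measurable_one.indicator (hs i)), lintegral_indicator_one (hs i)]
  have hbox : MeasurableSet ((fun (x : ∀ i, X i) i => T i (x i)) ⁻¹' Set.univ.pi s) :=
    (MeasurableSet.univ_pi hs).preimage (by fun_prop)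
  have hprod : ∀ x : ∀ i, X i, ((fun (x : ∀ i, X i) i => T i (x i)) ⁻¹' Set.univ.pi s).indicator
      (fun x => ENNReal.ofReal (Real.exp (-∑ i, L i (x i)))) x = ∏ i, g i (x i) := fun x => by
    rw [hg, Finset.prod_mul_distrib, ← ENNReal.ofReal_prod_of_nonneg fun i _ => (Real.exp_pos _).le,
      ← Real.exp_sum, Finset.sum_neg_distrib]
    by_cases hx : ∀ i, T i (x i) ∈ s i
    · simp [hx]
    · obtain ⟨i, hi⟩ := not_forall.1 hx
      rw [Finset.prod_eq_zero (Finset.mem_univ i) (Set.indicator_of_notMem hi 1), mul_zero,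
        Set.indicator_of_notMem (by simpa using ⟨i, hi⟩)]
  rw [Measure.map_apply (by fun_prop) (MeasurableSet.univ_pi hs), withDensity_apply _ hbox,
    ← lintegral_indicator hbox, lintegral_congr hprod,
    lintegral_prod_eq_prod_lintegral_of_indepFun Finset.univ (fun i (x : ∀ i, X i) => g i (x i))
      (iIndepFun_pi fun i => (hgm i).aemeasurable) fun i => (hgm i).comp (measurable_pi_apply i)]
  exact Finset.prod_congr rfl fun i _ => by
    rw [(measurePreserving_eval μ i).lintegral_comp (hgm i), hfactor]

end IsReweighting

theorem integral_le_log_of_lintegral_exp_le [IsProbabilityMeasure μ] {f : Ω → ℝ} {c : ℝ}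
    (hf : Integrable f μ)
    (h : ∫⁻ ω, ENNReal.ofReal (Real.exp (f ω)) ∂μ ≤ ENNReal.ofReal c) :
    ∫ ω, f ω ∂μ ≤ Real.log c := by
  have hexp : AEStronglyMeasurable (fun ω => Real.exp (f ω)) μ :=
    Real.continuous_exp.comp_aestronglyMeasurable hf.aestronglyMeasurable
  have hnonneg : 0 ≤ᵐ[μ] fun ω => Real.exp (f ω) := ae_of_all _ fun ω => (Real.exp_pos _).le
  have hint : Integrable (fun ω => Real.exp (f ω)) μ :=
    ⟨hexp, (hasFiniteIntegral_iff_ofReal hnonneg).2 (h.trans_lt ENNReal.ofReal_lt_top)⟩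
  have hjensen : Real.exp (∫ ω, f ω ∂μ) ≤ ∫ ω, Real.exp (f ω) ∂μ :=
    convexOn_exp.map_integral_le Real.continuous_exp.continuousOn isClosed_univ
      (ae_of_all _ fun ω => Set.mem_univ _) hf hint
  have hle : ENNReal.ofReal (Real.exp (∫ ω, f ω ∂μ)) ≤ ENNReal.ofReal c :=
    (ENNReal.ofReal_le_ofReal hjensen).trans
      ((ofReal_integral_eq_lintegral_ofReal hint hnonneg).trans_le h)
  have hc : 0 < c := ENNReal.ofReal_pos.1 ((ENNReal.ofReal_pos.2 (Real.exp_pos _)).trans_le hle)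
  exact (Real.le_log_iff_exp_le hc).2 ((ENNReal.ofReal_le_ofReal_iff hc.le).1 hle)

theorem IsReweighting.measureReal_mul_log_le [IsProbabilityMeasure μ] [IsProbabilityMeasure ν]
    {T : Ω → α} {L : Ω → ℝ} (h : IsReweighting T L μ ν) (hL : Integrable L μ) {E : Set α}
    (hE : MeasurableSet E) {K : ℕ} (hK : K ≠ 0) (hνE : ν E ≤ (K : ℝ≥0∞)⁻¹) :
    μ.real (T ⁻¹' E) * Real.log K ≤ ∫ ω, L ω ∂μ + Real.log 2 := by
  set g : Ω → ℝ := (T ⁻¹' E).indicator fun _ => Real.log K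
  have hC : MeasurableSet (T ⁻¹' E) := h.measurable hE
  have hgi : Integrable g μ := (integrable_const _).indicator hC
  have hpt : ∀ ω, ENNReal.ofReal (Real.exp (g ω - L ω)) ≤
      ENNReal.ofReal (Real.exp (-L ω)) * (1 + E.indicator (fun _ => (K : ℝ≥0∞)) (T ω)) :=
    fun ω => by
    rw [sub_eq_neg_add, Real.exp_add, ENNReal.ofReal_mul (Real.exp_pos _).le]
    gcongr
    by_cases hω : T ω ∈ E
    · have : g ω = Real.log K := Set.indicator_of_mem (s := T ⁻¹' E) hω _
      rw [this, Real.exp_log (by positivity), ENNReal.ofReal_natCast, Set.indicator_of_mem hω]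
      exact le_add_self
    · have : g ω = 0 := Set.indicator_of_notMem (s := T ⁻¹' E) hω _
      simp [this]
  have hexp : ∫⁻ ω, ENNReal.ofReal (Real.exp (g ω - L ω)) ∂μ ≤ ENNReal.ofReal 2 := calc
    _ ≤ ∫⁻ ω, ENNReal.ofReal (Real.exp (-L ω)) *
          (1 + E.indicator (fun _ => (K : ℝ≥0∞)) (T ω)) ∂μ := lintegral_mono hpt
    _ = ∫⁻ a, 1 + E.indicator (fun _ => (K : ℝ≥0∞)) a ∂ν :=
        h.lintegral_comp _ (measurable_const.add (measurable_const.indicator hE))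
    _ = 1 + K * ν E := by
        rw [lintegral_add_left measurable_const, lintegral_indicator_const hE, lintegral_one,
          measure_univ]
    _ ≤ 1 + K * (K : ℝ≥0∞)⁻¹ := by gcongr
    _ = ENNReal.ofReal 2 := by
        rw [ENNReal.mul_inv_cancel (by simpa using hK) (ENNReal.natCast_ne_top K),
          one_add_one_eq_two, ENNReal.ofReal_ofNat]
  have hjensen := integral_le_log_of_lintegral_exp_le (hgi.sub hL) hexp
  have hgint : ∫ ω, g ω ∂μ = μ.real (T ⁻¹' E) * Real.log K := integral_indicator_const _ hC
  rw [integral_sub' hgi hL, hgint] at hjensen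
  linarith

theorem measure_prod_guess_le [IsProbabilityMeasure ν] [Countable β] [MeasurableSingletonClass β]
    {ξ : Measure β} [SFinite ξ] {p : ℝ≥0∞} (hξ : ∀ m, ξ {m} ≤ p) {g : α → β} (hg : Measurable g) :
    (ξ.prod ν) {x | g x.2 = x.1} ≤ p := by
  have hmeas : MeasurableSet {x : β × α | g x.2 = x.1} :=
    measurableSet_eq_fun (hg.comp measurable_snd) measurable_fst
  rw [Measure.prod_apply_symm hmeas]
  calc ∫⁻ a, ξ ((fun m => (m, a)) ⁻¹' {x | g x.2 = x.1}) ∂ν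
      ≤ ∫⁻ _, p ∂ν := lintegral_mono fun a => by
        simpa [Set.preimage, eq_comm] using hξ (g a)
    _ = p := by simp

/-- A Fano inequality, with `∫ L` in place of the mutual information of `M` and `O`. -/
theorem IsReweighting.guess_mul_log_le [IsProbabilityMeasure μ] [IsProbabilityMeasure ν]
    [Countable β] [MeasurableSingletonClass β] {ξ : Measure β} [IsProbabilityMeasure ξ] {M : Ω → β}
    {O : Ω → α} {L : Ω → ℝ} (h : IsReweighting (fun ω => (M ω, O ω)) L μ (ξ.prod ν))
    (hL : Integrable L μ) {K : ℕ} (hK : K ≠ 0) (hξ : ∀ m, ξ {m} ≤ (K : ℝ≥0∞)⁻¹) {g : α → β}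
    (hg : Measurable g) :
    μ.real {ω | g (O ω) = M ω} * Real.log K ≤ ∫ ω, L ω ∂μ + Real.log 2 :=
  h.measureReal_mul_log_le hL (measurableSet_eq_fun (hg.comp measurable_snd) measurable_fst) hK
    (measure_prod_guess_le hξ hg)

end ChangeOfMeasure

section GaussianVectors

variable {ι Ω α β : Type*} [Fintype ι] [MeasurableSpace Ω] [MeasurableSpace α] [MeasurableSpace β]
  {μ : Measure Ω} {ν : Measure α} {ξ : Measure β} {κ v : ℝ≥0}

/-- The law of a vector with independent coordinates of law `N(0, v)`. -/
noncomputable abbrev iidGaussian (ι : Type*) [Fintype ι] (v : ℝ≥0) : Measure (ι → ℝ) :=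
  Measure.pi fun _ => gaussianReal 0 v

/-- The logarithm of the ratio between the density of `N(0, v)` at `z` and that of `N(0, κ v)` at
`x`: the price of regarding `x = d + z`, where `z` has law `N(0, v)`, as a sample of `N(0, κ v)`.
For `v = 0` both quadratic terms are `0` by the convention `a / 0 = 0`. -/
noncomputable def gaussianLogRatio (κ v : ℝ≥0) (x z : ℝ) : ℝ :=
  Real.log κ / 2 + x ^ 2 / (2 * (κ * v)) - z ^ 2 / (2 * v)

@[fun_prop]
theorem measurable_gaussianLogRatio {f g : Ω → ℝ} (hf : Measurable f) (hg : Measurable g) :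
    Measurable fun ω => gaussianLogRatio κ v (f ω) (g ω) := by
  unfold gaussianLogRatio
  fun_prop

theorem exp_neg_gaussianLogRatio_mul_gaussianPDFReal (hκ : κ ≠ 0) (m z : ℝ) :
    gaussianPDFReal 0 v z * Real.exp (-gaussianLogRatio κ v (m + z) z) =
      gaussianPDFReal (-m) (κ * v) z := by
  have hκ' : (0 : ℝ) < κ := by positivity
  have hexp : Real.exp (-gaussianLogRatio κ v (m + z) z) =
      (√κ)⁻¹ * Real.exp (-(z - -m) ^ 2 / (2 * (κ * v))) * Real.exp (z ^ 2 / (2 * v)) := by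
    rw [Real.sqrt_eq_rpow, Real.rpow_def_of_pos hκ', ← Real.exp_neg, ← Real.exp_add,
      ← Real.exp_add, gaussianLogRatio]
    ring_nf
  have hcancel : Real.exp (-z ^ 2 / (2 * v)) * Real.exp (z ^ 2 / (2 * v)) = 1 := by
    rw [← Real.exp_add, neg_div, neg_add_cancel, Real.exp_zero]
  have hsqrt : √(2 * Real.pi * (κ * v)) = √(2 * Real.pi * v) * √κ := by
    rw [← Real.sqrt_mul (by positivity)]
    ring_nf
  simp only [gaussianPDFReal_def, NNReal.coe_mul, sub_zero]
  rw [hexp, hsqrt, mul_inv]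
  linear_combination (√(2 * Real.pi * v))⁻¹ * (√κ)⁻¹ *
    Real.exp (-(z - -m) ^ 2 / (2 * (κ * v))) * hcancel

theorem isReweighting_const_add_gaussianReal (hκ : κ ≠ 0) {m : ℝ} (hv : v = 0 → κ = 1 ∧ m = 0) :
    IsReweighting (fun z => m + z) (fun z => gaussianLogRatio κ v (m + z) z) (gaussianReal 0 v)
      (gaussianReal 0 (κ * v)) := by
  refine .of_map_withDensity_eq (by fun_prop) (by fun_prop) ?_
  rcases eq_or_ne v 0 with rfl | hv0
  · obtain ⟨rfl, rfl⟩ := hv rfl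
    simp [gaussianLogRatio]
  · rw [gaussianReal_of_var_ne_zero _ hv0,
      ← withDensity_mul _ (measurable_gaussianPDF _ _) (by fun_prop)]
    have hdens : (gaussianPDF 0 v * fun z =>
        ENNReal.ofReal (Real.exp (-gaussianLogRatio κ v (m + z) z))) =
        gaussianPDF (-m) (κ * v) := funext fun z => by
      rw [Pi.mul_apply, gaussianPDF, gaussianPDF,
        ← ENNReal.ofReal_mul (gaussianPDFReal_nonneg _ _ _),
        exp_neg_gaussianLogRatio_mul_gaussianPDFReal hκ]
    rw [hdens, ← gaussianReal_of_var_ne_zero _ (mul_ne_zero hκ hv0), gaussianReal_map_const_add,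
      neg_add_cancel]

theorem isReweighting_add_iidGaussian {A : Ω → α} {Z : Ω → ι → ℝ}
    (h : MeasurePreserving (fun ω => (A ω, Z ω)) μ (ν.prod (iidGaussian ι v))) (hκ : κ ≠ 0)
    {d : α → ι → ℝ} (hd : Measurable d) (hv : v = 0 → κ = 1 ∧ d = 0) :
    IsReweighting (fun ω => (A ω, d (A ω) + Z ω))
      (fun ω => ∑ i, gaussianLogRatio κ v (d (A ω) i + Z ω i) (Z ω i)) μ
      (ν.prod (iidGaussian ι (κ * v))) := by
  have hfibre : ∀ a, IsReweighting (fun z => d a + z)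
      (fun z => ∑ i, gaussianLogRatio κ v (d a i + z i) (z i)) (iidGaussian ι v)
      (iidGaussian ι (κ * v)) := fun a =>
    .pi fun i => isReweighting_const_add_gaussianReal hκ fun h0 =>
      ⟨(hv h0).1, congrFun (congrFun (hv h0).2 a) i⟩
  exact (IsReweighting.skewProduct (by fun_prop) (by fun_prop) hfibre).comp_measurePreserving h

theorem memLp_coord {X : Ω → ι → ℝ} (hX : MeasurePreserving X μ (iidGaussian ι v)) (i : ι) :
    MemLp (fun ω => X ω i) 2 μ :=
  (memLp_id_gaussianReal 2).comp_measurePreserving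
    ((measurePreserving_eval (fun _ => gaussianReal 0 v) i).comp hX)

theorem integral_coord {X : Ω → ι → ℝ} (hX : MeasurePreserving X μ (iidGaussian ι v)) (i : ι) :
    ∫ ω, X ω i ∂μ = 0 := by
  have hi := (measurePreserving_eval (fun _ => gaussianReal 0 v) i).comp hX
  calc ∫ ω, X ω i ∂μ = ∫ x, x ∂(gaussianReal 0 v) := by
        rw [← hi.map_eq, integral_map hi.aemeasurable (by fun_prop)]
        rfl
    _ = 0 := integral_id_gaussianReal

theorem integral_coord_sq {X : Ω → ι → ℝ} (hX : MeasurePreserving X μ (iidGaussian ι v)) (i : ι) :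
    ∫ ω, X ω i ^ 2 ∂μ = v := by
  have hi := (measurePreserving_eval (fun _ => gaussianReal 0 v) i).comp hX
  calc ∫ ω, X ω i ^ 2 ∂μ = ∫ x, x ^ 2 ∂(gaussianReal 0 v) := by
        rw [← hi.map_eq, integral_map hi.aemeasurable (by fun_prop)]
        rfl
    _ = Var[fun x => x; gaussianReal 0 v] :=
        (variance_of_integral_eq_zero (by fun_prop) integral_id_gaussianReal).symm
    _ = v := variance_fun_id_gaussianReal

/-- A square integrable random vector whose average power `E[Xᵢ²]`, averaged over the coordinates,
is at most `P`. -/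
structure HasPowerLE (X : Ω → ι → ℝ) (P : ℝ) (μ : Measure Ω) : Prop where
  memLp : ∀ i, MemLp (fun ω => X ω i) 2 μ
  sum_integral_sq_le : ∑ i, ∫ ω, X ω i ^ 2 ∂μ ≤ Fintype.card ι * P

section LogRatio

variable [IsProbabilityMeasure μ] {X Z : Ω → ι → ℝ}

theorem integrable_gaussianLogRatio {f g : Ω → ℝ} (hf : MemLp f 2 μ) (hg : MemLp g 2 μ) :
    Integrable (fun ω => gaussianLogRatio κ v (f ω) (g ω)) μ :=
  ((integrable_const _).add (hf.integrable_sq.div_const _)).sub (hg.integrable_sq.div_const _)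

theorem integral_gaussianLogRatio {f g : Ω → ℝ} (hf : MemLp f 2 μ) (hg : MemLp g 2 μ) :
    ∫ ω, gaussianLogRatio κ v (f ω) (g ω) ∂μ =
      Real.log κ / 2 + (∫ ω, f ω ^ 2 ∂μ) / (2 * (κ * v)) - (∫ ω, g ω ^ 2 ∂μ) / (2 * v) := by
  have hfi := hf.integrable_sq.div_const (2 * (κ * v : ℝ))
  have hgi := hg.integrable_sq.div_const (2 * v : ℝ)
  have hsum : Integrable (fun ω => Real.log κ / 2 + f ω ^ 2 / (2 * (κ * v : ℝ))) μ :=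
    (integrable_const _).add hfi
  unfold gaussianLogRatio
  rw [integral_sub hsum hgi, integral_add (integrable_const _) hfi, integral_const,
    integral_div, integral_div, probReal_univ, one_smul]

theorem integrable_sum_gaussianLogRatio (hX : ∀ i, MemLp (fun ω => X ω i) 2 μ)
    (hZ : MeasurePreserving Z μ (iidGaussian ι v)) :
    Integrable (fun ω => ∑ i, gaussianLogRatio κ v (X ω i) (Z ω i)) μ :=
  integrable_finsetSum _ fun i _ => integrable_gaussianLogRatio (hX i) (memLp_coord hZ i)

theorem HasPowerLE.integral_sum_gaussianLogRatio_le (hX : HasPowerLE X (κ * v) μ) (hκ : κ ≠ 0)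
    (hZ : MeasurePreserving Z μ (iidGaussian ι v)) :
    ∫ ω, ∑ i, gaussianLogRatio κ v (X ω i) (Z ω i) ∂μ ≤ Fintype.card ι / 2 * Real.log κ := by
  rw [integral_finsetSum _ fun i _ => integrable_gaussianLogRatio (hX.memLp i) (memLp_coord hZ i)]
  simp only [fun i => integral_gaussianLogRatio (κ := κ) (v := v) (hX.memLp i) (memLp_coord hZ i),
    integral_coord_sq hZ, Finset.sum_sub_distrib, Finset.sum_add_distrib, ← Finset.sum_div,
    Finset.sum_const, Finset.card_univ, nsmul_eq_mul]
  rcases eq_or_ne v 0 with rfl | hv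
  · simp [mul_div_right_comm]
  · have hpow : (∑ i, ∫ ω, X ω i ^ 2 ∂μ) / (2 * (κ * v)) ≤ Fintype.card ι * v / (2 * v) := by
      rw [div_le_iff₀ (by positivity)]
      calc ∑ i, ∫ ω, X ω i ^ 2 ∂μ ≤ Fintype.card ι * (κ * v) := hX.sum_integral_sq_le
        _ = Fintype.card ι * v / (2 * v) * (2 * (κ * v)) := by field_simp
    linarith

end LogRatio

theorem gaussian_guess_mul_log_le [IsProbabilityMeasure μ] [IsProbabilityMeasure ν]
    [IsProbabilityMeasure ξ] [Countable β] [MeasurableSingletonClass β] {M : Ω → β} {A : Ω → α}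
    {Z : Ω → ι → ℝ}
    (h : MeasurePreserving (fun ω => ((M ω, A ω), Z ω)) μ ((ξ.prod ν).prod (iidGaussian ι v)))
    (hκ : κ ≠ 0) (hv : v ≠ 0) {d : β × α → ι → ℝ} (hd : Measurable d)
    (hpow : HasPowerLE (fun ω => d (M ω, A ω) + Z ω) (κ * v) μ) {K : ℕ} (hK : K ≠ 0)
    (hξ : ∀ m, ξ {m} ≤ (K : ℝ≥0∞)⁻¹) {g : α × (ι → ℝ) → β} (hg : Measurable g) :
    μ.real {ω | g (A ω, d (M ω, A ω) + Z ω) = M ω} * Real.log K ≤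
      Fintype.card ι / 2 * Real.log κ + Real.log 2 := by
  have hZ : MeasurePreserving Z μ (iidGaussian ι v) := measurePreserving_snd.comp h
  have hreweight := (isReweighting_add_iidGaussian h hκ hd fun h0 => absurd h0 hv)
    |>.measurePreserving_comp (measurePreserving_prodAssoc ξ ν (iidGaussian ι (κ * v)))
  exact (hreweight.guess_mul_log_le (integrable_sum_gaussianLogRatio hpow.memLp hZ) hK hξ hg).trans
    (add_le_add_left (hpow.integral_sum_gaussianLogRatio_le hκ hZ) _)

end GaussianVectors

section Power

variable {ι Ω α β : Type*} [Fintype ι] [MeasurableSpace Ω] [MeasurableSpace α] [MeasurableSpace β]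
  {μ : Measure Ω}

theorem indepFun_of_measurePreserving_prod [IsFiniteMeasure μ] {ν : Measure α} {ξ : Measure β}
    [IsProbabilityMeasure ν] [IsProbabilityMeasure ξ] {A : Ω → α} {B : Ω → β}
    (h : MeasurePreserving (fun ω => (A ω, B ω)) μ (ν.prod ξ)) : IndepFun A B μ := by
  have hA : MeasurePreserving A μ ν := measurePreserving_fst.comp h
  have hB : MeasurePreserving B μ ξ := measurePreserving_snd.comp h
  rw [indepFun_iff_map_prod_eq_prod_map_map hA.aemeasurable hB.aemeasurable, h.map_eq, hA.map_eq,
    hB.map_eq]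

theorem integral_mul_add_mul_sq {X Y : Ω → ℝ} (hX : MemLp X 2 μ) (hY : MemLp Y 2 μ) (a b : ℝ) :
    ∫ ω, (a * X ω + b * Y ω) ^ 2 ∂μ = a ^ 2 * ∫ ω, X ω ^ 2 ∂μ + 2 * a * b * ∫ ω, X ω * Y ω ∂μ +
      b ^ 2 * ∫ ω, Y ω ^ 2 ∂μ := by
  have hXX : Integrable (fun ω => a ^ 2 * X ω ^ 2) μ := hX.integrable_sq.const_mul _
  have hXY : Integrable (fun ω => 2 * a * b * (X ω * Y ω)) μ := (hX.integrable_mul hY).const_mul _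
  have hYY : Integrable (fun ω => b ^ 2 * Y ω ^ 2) μ := hY.integrable_sq.const_mul _
  have hsum : Integrable (fun ω => a ^ 2 * X ω ^ 2 + 2 * a * b * (X ω * Y ω)) μ := hXX.add hXY
  simp only [← integral_const_mul]
  rw [← integral_add hXX hXY, ← integral_add hsum hYY]
  exact integral_congr_ae (ae_of_all _ fun ω => by ring)

theorem integral_add_sq_of_indepFun {X Y : Ω → ℝ} (hX : MemLp X 2 μ) (hY : MemLp Y 2 μ)
    (hXY : IndepFun X Y μ) (hY0 : ∫ ω, Y ω ∂μ = 0) :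
    ∫ ω, (X ω + Y ω) ^ 2 ∂μ = ∫ ω, X ω ^ 2 ∂μ + ∫ ω, Y ω ^ 2 ∂μ := by
  have hcross : ∫ ω, X ω * Y ω ∂μ = 0 := by
    rw [hXY.integral_fun_mul_eq_mul_integral hX.aestronglyMeasurable hY.aestronglyMeasurable, hY0,
      mul_zero]
  simpa [hcross] using integral_mul_add_mul_sq hX hY 1 1

theorem sum_integral_smul_add_smul_sq {X Y : Ω → ι → ℝ} (hX : ∀ i, MemLp (fun ω => X ω i) 2 μ)
    (hY : ∀ i, MemLp (fun ω => Y ω i) 2 μ) (a b : ℝ) :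
    ∑ i, ∫ ω, (a • X ω + b • Y ω) i ^ 2 ∂μ = a ^ 2 * ∑ i, ∫ ω, X ω i ^ 2 ∂μ +
      2 * a * b * ∑ i, ∫ ω, X ω i * Y ω i ∂μ + b ^ 2 * ∑ i, ∫ ω, Y ω i ^ 2 ∂μ := by
  simp only [Finset.mul_sum, ← Finset.sum_add_distrib]
  exact Finset.sum_congr rfl fun i _ => integral_mul_add_mul_sq (hX i) (hY i) a b

namespace HasPowerLE

variable {X Y : Ω → ι → ℝ} {P P' : ℝ}

theorem of_lintegral {P : ℝ≥0} (hX : Measurable X)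
    (h : ∑ i, ∫⁻ ω, ENNReal.ofReal (X ω i ^ 2) ∂μ ≤ (Fintype.card ι : ℝ≥0∞) * P) :
    HasPowerLE X P μ := by
  have hmem : ∀ i, MemLp (fun ω => X ω i) 2 μ := fun i => by
    have hXi : Measurable fun ω => X ω i := by fun_prop
    rw [memLp_two_iff_integrable_sq hXi.aestronglyMeasurable]
    refine ⟨(hXi.pow_const 2).aestronglyMeasurable, ?_⟩
    rw [hasFiniteIntegral_iff_ofReal (ae_of_all _ fun _ => sq_nonneg _)]
    calc ∫⁻ ω, ENNReal.ofReal (X ω i ^ 2) ∂μ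
        ≤ ∑ j, ∫⁻ ω, ENNReal.ofReal (X ω j ^ 2) ∂μ :=
          Finset.single_le_sum (f := fun j => ∫⁻ ω, ENNReal.ofReal (X ω j ^ 2) ∂μ)
            (fun _ _ => zero_le) (Finset.mem_univ i)
      _ ≤ Fintype.card ι * P := h
      _ < ⊤ := ENNReal.mul_lt_top (ENNReal.natCast_lt_top _) ENNReal.coe_lt_top
  refine ⟨hmem, (ENNReal.ofReal_le_ofReal_iff (by positivity)).1 ?_⟩
  rw [ENNReal.ofReal_sum_of_nonneg fun i _ => integral_nonneg fun _ => sq_nonneg _,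
    ENNReal.ofReal_mul (Nat.cast_nonneg _), ENNReal.ofReal_natCast, ENNReal.ofReal_coe_nnreal]
  simpa only [ofReal_integral_eq_lintegral_ofReal (hmem _).integrable_sq
    (ae_of_all _ fun _ => sq_nonneg _)] using h

theorem of_iidGaussian {v : ℝ≥0} (hX : MeasurePreserving X μ (iidGaussian ι v)) :
    HasPowerLE X v μ where
  memLp := memLp_coord hX
  sum_integral_sq_le := by simp [integral_coord_sq hX]

theorem smul_add_smul (hX : HasPowerLE X P μ) (hY : HasPowerLE Y P' μ) {C : ℝ}
    (hC : ∑ i, ∫ ω, X ω i * Y ω i ∂μ = Fintype.card ι * C) (a b : ℝ) :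
    HasPowerLE (fun ω => a • X ω + b • Y ω) (a ^ 2 * P + 2 * a * b * C + b ^ 2 * P') μ where
  memLp i := ((hX.memLp i).const_mul a).add ((hY.memLp i).const_mul b)
  sum_integral_sq_le := by
    rw [sum_integral_smul_add_smul_sq hX.memLp hY.memLp, hC]
    linarith [mul_le_mul_of_nonneg_left hX.sum_integral_sq_le (sq_nonneg a),
      mul_le_mul_of_nonneg_left hY.sum_integral_sq_le (sq_nonneg b)]

theorem const_smul (hX : HasPowerLE X P μ) (a : ℝ) :
    HasPowerLE (fun ω => a • X ω) (a ^ 2 * P) μ where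
  memLp i := (hX.memLp i).const_mul a
  sum_integral_sq_le := by
    simp only [Pi.smul_apply, smul_eq_mul, mul_pow, integral_const_mul, ← Finset.mul_sum]
    linarith [mul_le_mul_of_nonneg_left hX.sum_integral_sq_le (sq_nonneg a)]

theorem add_of_indepFun (hX : HasPowerLE X P μ) (hY : HasPowerLE Y P' μ) (hXY : IndepFun X Y μ)
    (hY0 : ∀ i, ∫ ω, Y ω i ∂μ = 0) : HasPowerLE (fun ω => X ω + Y ω) (P + P') μ where
  memLp i := (hX.memLp i).add (hY.memLp i)
  sum_integral_sq_le := by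
    have hi : ∀ i, ∫ ω, (X ω + Y ω) i ^ 2 ∂μ = ∫ ω, X ω i ^ 2 ∂μ + ∫ ω, Y ω i ^ 2 ∂μ := fun i =>
      integral_add_sq_of_indepFun (hX.memLp i) (hY.memLp i)
        (hXY.comp (measurable_pi_apply i) (measurable_pi_apply i)) (hY0 i)
    simp only [hi, Finset.sum_add_distrib, mul_add]
    exact add_le_add hX.sum_integral_sq_le hY.sum_integral_sq_le

theorem sub_integral [IsProbabilityMeasure μ] (hX : HasPowerLE X P μ) :
    HasPowerLE (fun ω => X ω - fun i => ∫ ω', X ω' i ∂μ) P μ where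
  memLp i := (hX.memLp i).sub (memLp_const _)
  sum_integral_sq_le := (Finset.sum_le_sum fun i _ => by
    have hvar := variance_eq_integral (hX.memLp i).aemeasurable
    exact hvar.symm.trans_le (variance_le_expectation_sq (hX.memLp i).aestronglyMeasurable)).trans
      hX.sum_integral_sq_le

theorem abs_sum_integral_mul_le (hX : HasPowerLE X P μ) (hY : HasPowerLE Y P' μ) :
    |∑ i, ∫ ω, X ω i * Y ω i ∂μ| ≤ Fintype.card ι * √(P * P') := by
  set T := ∑ i, ∫ ω, X ω i * Y ω i ∂μ
  have hquad : ∀ t : ℝ, 0 ≤ Fintype.card ι * P' * (t * t) + 2 * T * t + Fintype.card ι * P :=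
    fun t => by
    have hnonneg : 0 ≤ ∑ i, ∫ ω, ((1 : ℝ) • X ω + t • Y ω) i ^ 2 ∂μ :=
      Finset.sum_nonneg fun i _ => integral_nonneg fun ω => sq_nonneg _
    rw [sum_integral_smul_add_smul_sq hX.memLp hY.memLp] at hnonneg
    linarith [mul_le_mul_of_nonneg_left hY.sum_integral_sq_le (sq_nonneg t), hX.sum_integral_sq_le]
  have hdiscrim := discrim_le_zero hquad
  rw [← Real.sqrt_sq (Nat.cast_nonneg (Fintype.card ι)), ← Real.sqrt_mul (sq_nonneg _)]
  refine Real.abs_le_sqrt ?_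
  rw [discrim] at hdiscrim
  linarith

theorem exists_correlation (hX : HasPowerLE X P μ) (hY : HasPowerLE Y P' μ) :
    ∃ ρ ∈ Set.Icc (-1 : ℝ) 1, (P' = 0 → ρ = 0) ∧
      ∑ i, ∫ ω, X ω i * Y ω i ∂μ = Fintype.card ι * (ρ * √(P * P')) := by
  have habs := hX.abs_sum_integral_mul_le hY
  set T := ∑ i, ∫ ω, X ω i * Y ω i ∂μ
  have hnonneg : 0 ≤ Fintype.card ι * √(P * P') := by positivity
  refine ⟨T / (Fintype.card ι * √(P * P')), ?_, fun h => by simp [h], ?_⟩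
  · rw [Set.mem_Icc, ← abs_le, abs_div, abs_of_nonneg hnonneg]
    exact div_le_one_of_le₀ habs hnonneg
  · rcases eq_or_ne (Fintype.card ι * √(P * P')) 0 with h0 | h0
    · rw [h0, abs_nonpos_iff] at habs
      rw [habs, zero_div, zero_mul, mul_zero]
    · rw [mul_left_comm, div_mul_cancel₀ _ h0]

end HasPowerLE

end Power

/-- The converse for a state `S` that is only used by the encoder: once the output `W` is made
independent of `(M, S)`, the state is resampled conditionally on `(M, W)`. The resampled state is
then dropped, but its second log-likelihood ratio, of expectation at most `log κ₂ / 2` per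
coordinate, is negative when `κ₂ < 1`. -/
theorem gaussian_guess_mul_log_le_of_state {ι Ω β : Type*} [Fintype ι] [MeasurableSpace Ω]
    [MeasurableSpace β] {μ : Measure Ω} [IsProbabilityMeasure μ] {ξ : Measure β}
    [IsProbabilityMeasure ξ] [Countable β] [MeasurableSingletonClass β] {κ₁ κ₂ q v : ℝ≥0}
    {M : Ω → β} {S Z W : Ω → ι → ℝ}
    (h : MeasurePreserving (fun ω => ((M ω, S ω), Z ω)) μ
      ((ξ.prod (iidGaussian ι q)).prod (iidGaussian ι v)))
    (hκ₁ : κ₁ ≠ 0) (hκ₂ : κ₂ ≠ 0) (hv : v ≠ 0) {d₁ d₂ : β × (ι → ℝ) → ι → ℝ}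
    (hd₁ : Measurable d₁) (hd₂ : Measurable d₂) (hq : q = 0 → κ₂ = 1 ∧ d₂ = 0)
    (hW : ∀ ω, W ω = d₁ (M ω, S ω) + Z ω) (hpow₁ : HasPowerLE W (κ₁ * v) μ)
    (hpow₂ : HasPowerLE (fun ω => d₂ (M ω, W ω) + S ω) (κ₂ * q) μ) {K : ℕ} (hK : K ≠ 0)
    (hξ : ∀ m, ξ {m} ≤ (K : ℝ≥0∞)⁻¹) {g : (ι → ℝ) → β} (hg : Measurable g) :
    μ.real {ω | g (W ω) = M ω} * Real.log K ≤
      Fintype.card ι / 2 * (Real.log κ₁ + Real.log κ₂) + Real.log 2 := by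
  have hZ : MeasurePreserving Z μ (iidGaussian ι v) := measurePreserving_snd.comp h
  have hS : MeasurePreserving S μ (iidGaussian ι q) :=
    measurePreserving_snd.comp (measurePreserving_fst.comp h)
  obtain rfl : W = fun ω => d₁ (M ω, S ω) + Z ω := funext hW
  have hrebracket : MeasurePreserving (fun x : (β × (ι → ℝ)) × (ι → ℝ) => ((x.1.1, x.2), x.1.2))
      ((ξ.prod (iidGaussian ι q)).prod (iidGaussian ι (κ₁ * v)))
      ((ξ.prod (iidGaussian ι (κ₁ * v))).prod (iidGaussian ι q)) :=
    (measurePreserving_prodAssoc ..).symm.comp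
      (((MeasurePreserving.id ξ).prod Measure.measurePreserving_swap).comp
        (measurePreserving_prodAssoc ..))
  have houtput := (isReweighting_add_iidGaussian h hκ₁ hd₁ fun h0 => absurd h0 hv)
    |>.measurePreserving_comp hrebracket
  have hstate := isReweighting_add_iidGaussian
    (.id ((ξ.prod (iidGaussian ι (κ₁ * v))).prod (iidGaussian ι q))) hκ₂ hd₂ hq
  have hreweight := (hstate.comp houtput).measurePreserving_comp measurePreserving_fst
  have hL₁ := integrable_sum_gaussianLogRatio (κ := κ₁) hpow₁.memLp hZ
  have hL₂ := integrable_sum_gaussianLogRatio (κ := κ₂) hpow₂.memLp hS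
  have hL : ∫ ω, (∑ i, gaussianLogRatio κ₁ v ((d₁ (M ω, S ω) + Z ω) i) (Z ω i) +
      ∑ i, gaussianLogRatio κ₂ q ((d₂ (M ω, d₁ (M ω, S ω) + Z ω) + S ω) i) (S ω i)) ∂μ ≤
      Fintype.card ι / 2 * (Real.log κ₁ + Real.log κ₂) := by
    rw [integral_add hL₁ hL₂, mul_add]
    exact add_le_add (hpow₁.integral_sum_gaussianLogRatio_le hκ₁ hZ)
      (hpow₂.integral_sum_gaussianLogRatio_le hκ₂ hS)
  exact (hreweight.guess_mul_log_le (hL₁.add hL₂) hK hξ hg).trans (add_le_add_left hL _)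

section VarianceParameters

/-- The variance of `X₁ + Z` per coordinate that remains once the linear estimate of `X₁` from the
state is removed, `ρ` being the correlation coefficient of `X₁` and the state. -/
noncomputable def residualVar (P₁ : ℝ≥0) (ρ : ℝ) : ℝ :=
  1 + P₁ * (1 - ρ ^ 2)

/-- The variance of `X₁ + S + Z` per coordinate: the noise seen by user 2. -/
noncomputable def interferenceVar (P₁ Q : ℝ≥0) (ρ : ℝ) : ℝ :=
  1 + P₁ + Q + 2 * ρ * √(P₁ * Q)

variable {P₁ Q : ℝ≥0} {ρ : ℝ}

theorem residualVar_pos (hρ : ρ ∈ Set.Icc (-1 : ℝ) 1) : 0 < residualVar P₁ ρ := by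
  have hsq : 0 ≤ 1 - ρ ^ 2 := by nlinarith [hρ.1, hρ.2]
  unfold residualVar
  positivity

theorem interferenceVar_pos (hρ : -1 ≤ ρ) : 0 < interferenceVar P₁ Q ρ := by
  have hamgm : 2 * √(P₁ * Q) ≤ P₁ + Q := by
    have hsq := two_mul_le_add_sq √(P₁ : ℝ) √Q
    rw [Real.sq_sqrt P₁.coe_nonneg, Real.sq_sqrt Q.coe_nonneg] at hsq
    rwa [Real.sqrt_mul P₁.coe_nonneg, ← mul_assoc]
  unfold interferenceVar
  nlinarith [Real.sqrt_nonneg (P₁ * Q : ℝ)]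

theorem monotone_interferenceVar : Monotone (interferenceVar P₁ Q) := fun _ _ h => by
  unfold interferenceVar
  gcongr

theorem residualVar_le_min_zero : residualVar P₁ ρ ≤ residualVar P₁ (min ρ 0) := by
  rcases le_total ρ 0 with h | h
  · rw [min_eq_left h]
  · rw [min_eq_right h]
    unfold residualVar
    gcongr

theorem sq_mul_sqrt_mul_coe : (ρ * √(P₁ * Q)) ^ 2 = ρ ^ 2 * (P₁ * Q) := by
  rw [mul_pow, Real.sq_sqrt (by positivity)]

theorem residualVar_div_interferenceVar_zero :
    residualVar P₁ 0 / interferenceVar P₁ 0 0 = 1 := by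
  have h : residualVar P₁ 0 = interferenceVar P₁ 0 0 := by simp [residualVar, interferenceVar]
  rw [h, div_self (interferenceVar_pos (by norm_num)).ne']

theorem log_add_interferenceVar_add_log_div (P₂ : ℝ≥0) (hρ : ρ ∈ Set.Icc (-1 : ℝ) 1) :
    Real.log (P₂ + interferenceVar P₁ Q ρ) +
        Real.log (residualVar P₁ ρ / interferenceVar P₁ Q ρ) =
      Real.log (1 + P₂ / interferenceVar P₁ Q ρ) + Real.log (residualVar P₁ ρ) := by
  have hτ : 0 < interferenceVar P₁ Q ρ := interferenceVar_pos hρ.1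
  rw [one_add_div hτ.ne', Real.log_div (residualVar_pos hρ).ne' hτ.ne',
    Real.log_div (by positivity) hτ.ne', add_comm (P₂ : ℝ)]
  ring

end VarianceParameters

section Law

variable {n k₁ k₂ : ℕ} {Q : ℝ≥0}

/-- The law of a uniformly distributed message. -/
noncomputable abbrev uniformMessage (k : ℕ) : Measure (Fin k) :=
  uniformOn Set.univ

instance isProbabilityMeasure_uniformMessage (k : ℕ) [NeZero k] :
    IsProbabilityMeasure (uniformMessage k) :=
  isProbabilityMeasure_uniformOn Set.finite_univ Set.univ_nonempty

instance isProbabilityMeasure_dirtyMACLaw [NeZero k₁] [NeZero k₂] :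
    IsProbabilityMeasure (dirtyMACLaw n k₁ k₂ Q) := by
  unfold dirtyMACLaw
  infer_instance

theorem uniformMessage_singleton {k : ℕ} (m : Fin k) : uniformMessage k {m} = (k : ℝ≥0∞)⁻¹ := by
  simp [uniformMessage, uniformOn_univ]

theorem uniformMessage_prod_singleton (m : Fin k₁ × Fin k₂) :
    (uniformMessage k₁).prod (uniformMessage k₂) {m} = ((k₁ * k₂ : ℕ) : ℝ≥0∞)⁻¹ := by
  rw [← Set.singleton_prod_singleton, Measure.prod_prod, uniformMessage_singleton,
    uniformMessage_singleton, Nat.cast_mul, ENNReal.mul_inv (by simp) (by simp)]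

theorem measurePreserving_message₁_first :
    MeasurePreserving
      (fun ω : DirtyMACOutcome n k₁ k₂ => ((ω.1, (ω.2.1, ω.2.2.1)), ω.2.2.2))
      (dirtyMACLaw n k₁ k₂ Q)
      (((uniformMessage k₁).prod ((uniformMessage k₂).prod (iidGaussian (Fin n) Q))).prod
        (iidGaussian (Fin n) 1)) :=
  (measurePreserving_prodAssoc ..).symm.comp
    ((MeasurePreserving.id _).prod (measurePreserving_prodAssoc ..).symm)

theorem measurePreserving_messages_first :
    MeasurePreserving
      (fun ω : DirtyMACOutcome n k₁ k₂ => (((ω.1, ω.2.1), ω.2.2.1), ω.2.2.2))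
      (dirtyMACLaw n k₁ k₂ Q)
      ((((uniformMessage k₁).prod (uniformMessage k₂)).prod (iidGaussian (Fin n) Q)).prod
        (iidGaussian (Fin n) 1)) :=
  ((measurePreserving_prodAssoc ..).symm.prod (.id _)).comp measurePreserving_message₁_first

theorem measurePreserving_message₂_first :
    MeasurePreserving
      (fun ω : DirtyMACOutcome n k₁ k₂ => ((ω.2.1, (ω.1, ω.2.2.1)), ω.2.2.2))
      (dirtyMACLaw n k₁ k₂ Q)
      (((uniformMessage k₂).prod ((uniformMessage k₁).prod (iidGaussian (Fin n) Q))).prod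
        (iidGaussian (Fin n) 1)) :=
  (((measurePreserving_prodAssoc ..).comp
    (Measure.measurePreserving_swap.prod (.id _))).prod (.id _)).comp
      measurePreserving_messages_first

end Law

namespace DirtyMACCode

variable {n k₁ k₂ : ℕ} {c : DirtyMACCode n k₁ k₂} {P₁ P₂ Q : ℝ≥0} {ρ : ℝ}

attribute [fun_prop] measurable_dec

@[fun_prop]
theorem measurable_uncurry_enc₁ (c : DirtyMACCode n k₁ k₂) :
    Measurable (Function.uncurry c.enc₁) :=
  measurable_from_prod_countable_right c.measurable_enc₁

theorem measurable_X₁ (c : DirtyMACCode n k₁ k₂) : Measurable c.X₁ :=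
  c.measurable_uncurry_enc₁.comp (by fun_prop : Measurable fun ω : DirtyMACOutcome n k₁ k₂ =>
    (ω.1, ω.2.2.1))

theorem measurable_X₂ (c : DirtyMACCode n k₁ k₂) : Measurable c.X₂ :=
  (measurable_of_countable c.enc₂).comp (by fun_prop : Measurable fun ω :
    DirtyMACOutcome n k₁ k₂ => ω.2.1)

theorem SatisfiesPower.hasPowerLE_X₁ (hc : c.SatisfiesPower P₁ P₂ Q) :
    HasPowerLE c.X₁ P₁ (dirtyMACLaw n k₁ k₂ Q) :=
  .of_lintegral c.measurable_X₁ (by simpa using hc.1)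

theorem SatisfiesPower.hasPowerLE_X₂ (hc : c.SatisfiesPower P₁ P₂ Q) :
    HasPowerLE c.X₂ P₂ (dirtyMACLaw n k₁ k₂ Q) :=
  .of_lintegral c.measurable_X₂ (by simpa using hc.2)

/-- `ρ` is the average correlation of the input of user 1 with the state, relative to the full
power `P₁` rather than the power actually used; it is `0` when there is no state. -/
structure IsStateCorrelation (c : DirtyMACCode n k₁ k₂) (P₁ Q : ℝ≥0) (ρ : ℝ) : Prop where
  mem_Icc : ρ ∈ Set.Icc (-1 : ℝ) 1
  eq_zero : Q = 0 → ρ = 0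
  sum_integral_mul_eq :
    ∑ i, ∫ ω, c.X₁ ω i * ω.2.2.1 i ∂(dirtyMACLaw n k₁ k₂ Q) = n * (ρ * √(P₁ * Q))

variable [NeZero k₁] [NeZero k₂]

theorem one_sub_errorProb_le {C : Set (DirtyMACOutcome n k₁ k₂)}
    (hC : ∀ ω, c.dec (c.Y ω) = (ω.1, ω.2.1) → ω ∈ C) :
    1 - c.errorProb Q ≤ (dirtyMACLaw n k₁ k₂ Q).real C := by
  have hcover : (Set.univ : Set (DirtyMACOutcome n k₁ k₂)) ⊆
      {ω | c.dec (c.Y ω) ≠ (ω.1, ω.2.1)} ∪ C := fun ω _ => by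
    by_cases h : c.dec (c.Y ω) = (ω.1, ω.2.1)
    · exact .inr (hC ω h)
    · exact .inl h
  have hunion := (measureReal_mono (μ := dirtyMACLaw n k₁ k₂ Q) hcover).trans
    (measureReal_union_le _ _)
  rw [probReal_univ] at hunion
  exact sub_le_iff_le_add'.2 hunion

theorem measurePreserving_state :
    MeasurePreserving (fun ω : DirtyMACOutcome n k₁ k₂ => ω.2.2.1) (dirtyMACLaw n k₁ k₂ Q)
      (iidGaussian (Fin n) Q) :=
  measurePreserving_fst.comp (measurePreserving_snd.comp measurePreserving_snd)

theorem measurePreserving_noise :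
    MeasurePreserving (fun ω : DirtyMACOutcome n k₁ k₂ => ω.2.2.2) (dirtyMACLaw n k₁ k₂ Q)
      (iidGaussian (Fin n) 1) :=
  measurePreserving_snd.comp (measurePreserving_snd.comp measurePreserving_snd)

theorem indepFun_noise :
    IndepFun (fun ω : DirtyMACOutcome n k₁ k₂ => (ω.1, ω.2.1, ω.2.2.1)) (fun ω => ω.2.2.2)
      (dirtyMACLaw n k₁ k₂ Q) :=
  indepFun_of_measurePreserving_prod measurePreserving_message₁_first

theorem hasPowerLE_state :
    HasPowerLE (fun ω : DirtyMACOutcome n k₁ k₂ => ω.2.2.1) Q (dirtyMACLaw n k₁ k₂ Q) :=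
  .of_iidGaussian measurePreserving_state

theorem SatisfiesPower.exists_isStateCorrelation (hc : c.SatisfiesPower P₁ P₂ Q) :
    ∃ ρ, c.IsStateCorrelation P₁ Q ρ := by
  obtain ⟨ρ, hρ, hρ0, hcorr⟩ := hc.hasPowerLE_X₁.exists_correlation hasPowerLE_state
  exact ⟨ρ, hρ, fun h => hρ0 (by simp [h]), by simpa using hcorr⟩

theorem IsStateCorrelation.hasPowerLE_smul_add_smul (hρ : c.IsStateCorrelation P₁ Q ρ)
    (hc : c.SatisfiesPower P₁ P₂ Q) (a b : ℝ) :
    HasPowerLE (fun ω => a • c.X₁ ω + b • ω.2.2.1)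
      (a ^ 2 * P₁ + 2 * a * b * (ρ * √(P₁ * Q)) + b ^ 2 * Q) (dirtyMACLaw n k₁ k₂ Q) :=
  hc.hasPowerLE_X₁.smul_add_smul hasPowerLE_state (by simpa using hρ.sum_integral_mul_eq) a b

theorem hasPowerLE_add_smul_noise {x : Fin k₁ × Fin k₂ × (Fin n → ℝ) → Fin n → ℝ} {P : ℝ}
    (hx : Measurable x)
    (hP : HasPowerLE (fun ω => x (ω.1, ω.2.1, ω.2.2.1)) P (dirtyMACLaw n k₁ k₂ Q)) (a : ℝ) :
    HasPowerLE (fun ω => x (ω.1, ω.2.1, ω.2.2.1) + a • ω.2.2.2) (P + a ^ 2)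
      (dirtyMACLaw n k₁ k₂ Q) := by
  have hZ : HasPowerLE (fun ω : DirtyMACOutcome n k₁ k₂ => ω.2.2.2) (1 : ℝ≥0)
      (dirtyMACLaw n k₁ k₂ Q) := .of_iidGaussian measurePreserving_noise
  have hsum := hP.add_of_indepFun (hZ.const_smul a)
    (indepFun_noise.comp hx (measurable_const_smul a)) fun i => by
      simp [integral_const_mul, integral_coord measurePreserving_noise i]
  simpa using hsum

theorem IsStateCorrelation.hasPowerLE_residual (hρ : c.IsStateCorrelation P₁ Q ρ)
    (hc : c.SatisfiesPower P₁ P₂ Q) :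
    HasPowerLE (fun ω => c.X₁ ω - (ρ * √(P₁ * Q) / Q) • ω.2.2.1 + ω.2.2.2) (residualVar P₁ ρ)
      (dirtyMACLaw n k₁ k₂ Q) := by
  have hadd := hasPowerLE_add_smul_noise
    (x := fun x => (1 : ℝ) • c.enc₁ x.1 x.2.2 + (-(ρ * √(P₁ * Q) / Q)) • x.2.2)
    (by fun_prop) (hρ.hasPowerLE_smul_add_smul hc 1 (-(ρ * √(P₁ * Q) / Q))) 1
  convert hadd using 1
  · ext ω i
    simp [X₁, sub_eq_add_neg]
  · unfold residualVar
    rcases eq_or_ne Q 0 with h0 | h0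
    · simp [h0, hρ.eq_zero h0, add_comm]
    · have hQ : (Q : ℝ) ≠ 0 := by simpa using h0
      field_simp
      linear_combination sq_mul_sqrt_mul_coe (P₁ := P₁) (Q := Q) (ρ := ρ)

theorem SatisfiesPower.hasPowerLE_X₂_add_noise (hc : c.SatisfiesPower P₁ P₂ Q) :
    HasPowerLE (fun ω => c.X₂ ω + ω.2.2.2) (P₂ + 1) (dirtyMACLaw n k₁ k₂ Q) := by
  simpa [X₂] using
    hasPowerLE_add_smul_noise (x := fun x => c.enc₂ x.2.1) (by fun_prop) hc.hasPowerLE_X₂ 1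

/-- The mean of the input of user 2. It is subtracted from the output, so that the remaining part of
`X₂` is uncorrelated with `X₁ + S` even when both have nonzero means. -/
noncomputable def meanX₂ (c : DirtyMACCode n k₁ k₂) (Q : ℝ≥0) : Fin n → ℝ :=
  fun i => ∫ ω, c.X₂ ω i ∂(dirtyMACLaw n k₁ k₂ Q)

theorem IsStateCorrelation.hasPowerLE_output (hρ : c.IsStateCorrelation P₁ Q ρ)
    (hc : c.SatisfiesPower P₁ P₂ Q) :
    HasPowerLE (fun ω => c.X₁ ω + ω.2.2.1 + (c.X₂ ω - c.meanX₂ Q) + ω.2.2.2)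
      (P₂ + interferenceVar P₁ Q ρ) (dirtyMACLaw n k₁ k₂ Q) := by
  have hindep : IndepFun (fun ω : DirtyMACOutcome n k₁ k₂ => (ω.1, ω.2.2.1)) (fun ω => ω.2.1)
      (dirtyMACLaw n k₁ k₂ Q) :=
    (indepFun_of_measurePreserving_prod
      (measurePreserving_fst.comp measurePreserving_message₂_first)).symm
  have hcognitive := hρ.hasPowerLE_smul_add_smul hc 1 1
  have hinputs := hcognitive.add_of_indepFun hc.hasPowerLE_X₂.sub_integral
    (hindep.comp (φ := fun x : Fin k₁ × (Fin n → ℝ) => (1 : ℝ) • c.enc₁ x.1 x.2 + (1 : ℝ) • x.2)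
      (ψ := fun m => c.enc₂ m - c.meanX₂ Q) (by fun_prop) (by fun_prop)) fun i => by
      simp [integral_sub ((hc.hasPowerLE_X₂.memLp i).integrable one_le_two)]
  have hadd := hasPowerLE_add_smul_noise
    (x := fun x => (1 : ℝ) • c.enc₁ x.1 x.2.2 + (1 : ℝ) • x.2.2 + (c.enc₂ x.2.1 - c.meanX₂ Q))
    (by fun_prop) hinputs 1
  convert hadd using 1
  · ext ω i
    simp [X₁, X₂]
  · unfold interferenceVar
    ring

theorem IsStateCorrelation.hasPowerLE_stateError (hρ : c.IsStateCorrelation P₁ Q ρ)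
    (hc : c.SatisfiesPower P₁ P₂ Q) :
    HasPowerLE (fun ω => ω.2.2.1 - ((Q + ρ * √(P₁ * Q)) / interferenceVar P₁ Q ρ) •
        (c.X₁ ω + ω.2.2.1 + ω.2.2.2))
      (residualVar P₁ ρ / interferenceVar P₁ Q ρ * Q) (dirtyMACLaw n k₁ k₂ Q) := by
  set α := (Q + ρ * √(P₁ * Q)) / interferenceVar P₁ Q ρ
  have hadd := hasPowerLE_add_smul_noise (x := fun x => (-α) • c.enc₁ x.1 x.2.2 + (1 - α) • x.2.2)
    (by fun_prop) (hρ.hasPowerLE_smul_add_smul hc (-α) (1 - α)) (-α)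
  convert hadd using 1
  · ext ω i
    simp only [X₁, Pi.add_apply, Pi.sub_apply, Pi.smul_apply, smul_eq_mul]
    ring
  · have hτ : interferenceVar P₁ Q ρ = 1 + P₁ + Q + 2 * ρ * √(P₁ * Q) := rfl
    have hτ0 := (interferenceVar_pos (P₁ := P₁) (Q := Q) hρ.mem_Icc.1).ne'
    have hατ : α * interferenceVar P₁ Q ρ = Q + ρ * √(P₁ * Q) := div_mul_cancel₀ _ hτ0
    rw [div_mul_eq_mul_div, div_eq_iff hτ0]
    unfold residualVar
    linear_combination sq_mul_sqrt_mul_coe (P₁ := P₁) (Q := Q) (ρ := ρ) -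
      (α * interferenceVar P₁ Q ρ - (Q + ρ * √(P₁ * Q))) * hατ +
      (α ^ 2 * interferenceVar P₁ Q ρ - Q) * hτ

theorem IsStateCorrelation.one_sub_errorProb_mul_log_card₁_le
    (hρ : c.IsStateCorrelation P₁ Q ρ) (hc : c.SatisfiesPower P₁ P₂ Q) :
    (1 - c.errorProb Q) * Real.log k₁ ≤ n / 2 * Real.log (residualVar P₁ ρ) + Real.log 2 := by
  have hpos : 0 < residualVar P₁ ρ := residualVar_pos hρ.mem_Icc
  have hpow := hρ.hasPowerLE_residual hc
  lift residualVar P₁ ρ to ℝ≥0 using hpos.le with κ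
  set β := ρ * √(P₁ * Q) / Q
  have hguess := gaussian_guess_mul_log_le measurePreserving_message₁_first (κ := κ)
    (d := fun x => c.enc₁ x.1 x.2.2 - β • x.2.2)
    (g := fun x => (c.dec (x.2 + (c.enc₂ x.1.1 + (1 + β) • x.1.2))).1)
    (by exact_mod_cast hpos.ne') one_ne_zero (by fun_prop) (by simpa [X₁] using hpow) (NeZero.ne k₁)
    (fun m => (uniformMessage_singleton m).le) (by fun_prop)
  rw [Fintype.card_fin] at hguess
  refine (mul_le_mul_of_nonneg_right (c.one_sub_errorProb_le fun ω hω => ?_)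
    (Real.log_natCast_nonneg k₁)).trans hguess
  have hY : c.enc₁ ω.1 ω.2.2.1 - β • ω.2.2.1 + ω.2.2.2 + (c.enc₂ ω.2.1 + (1 + β) • ω.2.2.1) =
      c.Y ω := by
    simp only [Y, X₁, X₂]
    module
  simp [hY, hω]

theorem SatisfiesPower.one_sub_errorProb_mul_log_card₂_le (hc : c.SatisfiesPower P₁ P₂ Q) :
    (1 - c.errorProb Q) * Real.log k₂ ≤ n / 2 * Real.log (1 + P₂) + Real.log 2 := by
  have hguess := gaussian_guess_mul_log_le measurePreserving_message₂_first (κ := 1 + P₂)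
    (d := fun x => c.enc₂ x.1)
    (g := fun x => (c.dec (x.2 + (c.enc₁ x.1.1 x.1.2 + x.1.2))).2)
    (by positivity) one_ne_zero (by fun_prop)
    (by simpa [X₂, add_comm (1 : ℝ)] using hc.hasPowerLE_X₂_add_noise) (NeZero.ne k₂)
    (fun m => (uniformMessage_singleton m).le) (by fun_prop)
  rw [Fintype.card_fin, NNReal.coe_add, NNReal.coe_one] at hguess
  refine (mul_le_mul_of_nonneg_right (c.one_sub_errorProb_le fun ω hω => ?_)
    (Real.log_natCast_nonneg k₂)).trans hguess
  have hY : c.enc₂ ω.2.1 + ω.2.2.2 + (c.enc₁ ω.1 ω.2.2.1 + ω.2.2.1) = c.Y ω := by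
    simp only [Y, X₁, X₂]
    module
  simp [hY, hω]

theorem one_sub_errorProb_mul_log_card_le_of_hasPowerLE {V κ : ℝ≥0} {α : ℝ} {x : Fin n → ℝ}
    (hV : V ≠ 0) (hκ : κ ≠ 0) (hQ : Q = 0 → κ = 1 ∧ α = 0)
    (houtput : HasPowerLE (fun ω => c.X₁ ω + ω.2.2.1 + (c.X₂ ω - x) + ω.2.2.2) V
      (dirtyMACLaw n k₁ k₂ Q))
    (hstate : HasPowerLE (fun ω => ω.2.2.1 - α • (c.X₁ ω + ω.2.2.1 + ω.2.2.2)) (κ * Q)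
      (dirtyMACLaw n k₁ k₂ Q)) :
    (1 - c.errorProb Q) * (Real.log k₁ + Real.log k₂) ≤
      n / 2 * (Real.log V + Real.log κ) + Real.log 2 := by
  have hguess := gaussian_guess_mul_log_le_of_state
    (W := fun ω => c.X₁ ω + ω.2.2.1 + (c.X₂ ω - x) + ω.2.2.2) (κ₁ := V) (κ₂ := κ)
    (d₁ := fun p => c.enc₁ p.1.1 p.2 + p.2 + (c.enc₂ p.1.2 - x))
    (d₂ := fun p => (-α) • (p.2 - (c.enc₂ p.1.2 - x))) (g := fun w => c.dec (w + x))
    measurePreserving_messages_first hV hκ one_ne_zero (by fun_prop) (by fun_prop)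
    (fun h => ⟨(hQ h).1, by ext; simp [(hQ h).2]⟩) (fun ω => rfl) (by simpa using houtput)
    (by
      convert hstate using 2 with ω
      simp only [X₁, X₂]
      module)
    (mul_ne_zero (NeZero.ne k₁) (NeZero.ne k₂))
    (fun m => (uniformMessage_prod_singleton m).le) (by fun_prop)
  rw [Fintype.card_fin, Nat.cast_mul, Real.log_mul (Nat.cast_ne_zero.2 (NeZero.ne k₁))
    (Nat.cast_ne_zero.2 (NeZero.ne k₂))] at hguess
  refine (mul_le_mul_of_nonneg_right (c.one_sub_errorProb_le fun ω hω => ?_)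
    (add_nonneg (Real.log_natCast_nonneg k₁) (Real.log_natCast_nonneg k₂))).trans hguess
  have hY : c.X₁ ω + ω.2.2.1 + (c.X₂ ω - x) + ω.2.2.2 + x = c.Y ω := by
    simp only [Y]
    module
  simp [hY, hω]

theorem IsStateCorrelation.one_sub_errorProb_mul_log_card_le
    (hρ : c.IsStateCorrelation P₁ Q ρ) (hc : c.SatisfiesPower P₁ P₂ Q) :
    (1 - c.errorProb Q) * (Real.log k₁ + Real.log k₂) ≤
      n / 2 * (Real.log (1 + P₂ / interferenceVar P₁ Q ρ) + Real.log (residualVar P₁ ρ)) +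
        Real.log 2 := by
  have hσ : 0 < residualVar P₁ ρ := residualVar_pos hρ.mem_Icc
  have hτ : 0 < interferenceVar P₁ Q ρ := interferenceVar_pos hρ.mem_Icc.1
  have hV : 0 < P₂ + interferenceVar P₁ Q ρ := by positivity
  have hκ : 0 < residualVar P₁ ρ / interferenceVar P₁ Q ρ := by positivity
  have hκ0 : Q = 0 → residualVar P₁ ρ / interferenceVar P₁ Q ρ = 1 := fun h => by
    rw [hρ.eq_zero h, h, residualVar_div_interferenceVar_zero]
  have houtput := hρ.hasPowerLE_output hc
  have hstate := hρ.hasPowerLE_stateError hc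
  rw [← log_add_interferenceVar_add_log_div P₂ hρ.mem_Icc]
  lift P₂ + interferenceVar P₁ Q ρ to ℝ≥0 using hV.le with V
  lift residualVar P₁ ρ / interferenceVar P₁ Q ρ to ℝ≥0 using hκ.le with κ
  exact one_sub_errorProb_mul_log_card_le_of_hasPowerLE (by exact_mod_cast hV.ne')
    (by exact_mod_cast hκ.ne') (fun h => ⟨by exact_mod_cast hκ0 h, by simp [h, hρ.eq_zero h]⟩)
    houtput hstate

end DirtyMACCode

section OuterRegion

variable {b : ℝ} {P₁ P₂ Q : ℝ≥0}

/-- The rate pairs, to base `b`, allowed by the outer bound for some `ρ ∈ [-1, 0]`. -/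
def dirtyMACOuterRegion (b : ℝ) (P₁ P₂ Q : ℝ≥0) : Set (ℝ × ℝ) :=
  {R | ∃ ρ ∈ Set.Icc (-1 : ℝ) 0,
    R.1 ≤ 1 / 2 * Real.logb b (residualVar P₁ ρ) ∧
    R.2 ≤ 1 / 2 * Real.logb b (1 + P₂) ∧
    R.1 + R.2 ≤ 1 / 2 * Real.logb b (1 + P₂ / interferenceVar P₁ Q ρ) +
      1 / 2 * Real.logb b (residualVar P₁ ρ)}

theorem isLowerSet_dirtyMACOuterRegion : IsLowerSet (dirtyMACOuterRegion b P₁ P₂ Q) :=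
  fun _ _ hle ⟨ρ, hρ, h₁, h₂, hsum⟩ =>
    ⟨ρ, hρ, hle.1.trans h₁, hle.2.trans h₂, (add_le_add hle.1 hle.2).trans hsum⟩

theorem isClosed_dirtyMACOuterRegion : IsClosed (dirtyMACOuterRegion b P₁ P₂ Q) := by
  have hσ : Continuous fun ρ : Set.Icc (-1 : ℝ) 0 => Real.logb b (residualVar P₁ ρ) := by
    refine Continuous.logb (by unfold residualVar; fun_prop) fun ρ => ?_
    exact (residualVar_pos ⟨ρ.2.1, ρ.2.2.trans zero_le_one⟩).ne'
  have hτ : Continuous fun ρ : Set.Icc (-1 : ℝ) 0 =>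
      Real.logb b (1 + P₂ / interferenceVar P₁ Q ρ) := by
    have hpos : ∀ ρ : Set.Icc (-1 : ℝ) 0, 0 < interferenceVar P₁ Q ρ := fun ρ =>
      interferenceVar_pos ρ.2.1
    refine Continuous.logb (continuous_const.add (continuous_const.div ?_ fun ρ => (hpos ρ).ne'))
      fun ρ => ?_
    · unfold interferenceVar
      fun_prop
    · have := hpos ρ
      positivity
  have hclosed : IsClosed {p : (ℝ × ℝ) × Set.Icc (-1 : ℝ) 0 |
      p.1.1 ≤ 1 / 2 * Real.logb b (residualVar P₁ p.2) ∧
      p.1.2 ≤ 1 / 2 * Real.logb b (1 + P₂) ∧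
      p.1.1 + p.1.2 ≤ 1 / 2 * Real.logb b (1 + P₂ / interferenceVar P₁ Q p.2) +
        1 / 2 * Real.logb b (residualVar P₁ p.2)} :=
    .and (isClosed_le (by fun_prop) (continuous_const.mul (hσ.comp continuous_snd)))
      (.and (isClosed_le (by fun_prop) continuous_const)
        (isClosed_le (by fun_prop) ((continuous_const.mul (hτ.comp continuous_snd)).add
          (continuous_const.mul (hσ.comp continuous_snd)))))
  convert isClosedMap_fst_of_compactSpace _ hclosed using 1
  ext R
  exact ⟨fun ⟨ρ, hρ, h⟩ => ⟨(R, ⟨ρ, hρ⟩), h, rfl⟩, fun ⟨⟨_, ρ⟩, h, hR⟩ => hR ▸ ⟨ρ, ρ.2, h⟩⟩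

theorem mem_dirtyMACOuterRegion_of_mem_Icc {x₁ x₂ ρ : ℝ} (hb : 1 < b) (hρ : ρ ∈ Set.Icc (-1 : ℝ) 1)
    (h₁ : x₁ ≤ 1 / 2 * Real.logb b (residualVar P₁ ρ))
    (h₂ : x₂ ≤ 1 / 2 * Real.logb b (1 + P₂))
    (hsum : x₁ + x₂ ≤ 1 / 2 * Real.logb b (1 + P₂ / interferenceVar P₁ Q ρ) +
      1 / 2 * Real.logb b (residualVar P₁ ρ)) :
    (x₁, x₂) ∈ dirtyMACOuterRegion b P₁ P₂ Q := by
  have hmin : -1 ≤ min ρ 0 := le_min hρ.1 (by norm_num)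
  have hσ : Real.logb b (residualVar P₁ ρ) ≤ Real.logb b (residualVar P₁ (min ρ 0)) :=
    Real.logb_le_logb_of_le hb (residualVar_pos hρ) residualVar_le_min_zero
  have hτ : Real.logb b (1 + P₂ / interferenceVar P₁ Q ρ) ≤
      Real.logb b (1 + P₂ / interferenceVar P₁ Q (min ρ 0)) := by
    have hpos := interferenceVar_pos (P₁ := P₁) (Q := Q) hρ.1
    have hpos' := interferenceVar_pos (P₁ := P₁) (Q := Q) hmin
    refine Real.logb_le_logb_of_le hb (by positivity) ?_
    gcongr
    exact monotone_interferenceVar (min_le_left ρ 0)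
  exact ⟨min ρ 0, ⟨hmin, min_le_right ρ 0⟩, by linarith, h₂, by linarith⟩

theorem rate_le_of_mul_log_le {n : ℕ} {x y : ℝ} (hb : 1 < b) (hn : n ≠ 0)
    (h : x ≤ n / 2 * y + Real.log 2) :
    (x / Real.log b - Real.logb b 2) / n ≤ 1 / 2 * (y / Real.log b) := by
  have hlog : 0 < Real.log b := Real.log_pos hb
  rw [Real.logb, ← sub_div, div_div, div_le_iff₀ (by positivity)]
  field_simp
  linarith

theorem DirtyMACCode.SatisfiesPower.rates_mem_outerRegion {n k₁ k₂ : ℕ} [NeZero k₁] [NeZero k₂]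
    {c : DirtyMACCode n k₁ k₂} (hc : c.SatisfiesPower P₁ P₂ Q) (hb : 1 < b) (hn : n ≠ 0) :
    (((1 - c.errorProb Q) * Real.logb b k₁ - Real.logb b 2) / n,
      ((1 - c.errorProb Q) * Real.logb b k₂ - Real.logb b 2) / n) ∈
      dirtyMACOuterRegion b P₁ P₂ Q := by
  obtain ⟨ρ, hρ⟩ := hc.exists_isStateCorrelation
  have h₁ := rate_le_of_mul_log_le hb hn (hρ.one_sub_errorProb_mul_log_card₁_le hc)
  have h₂ := rate_le_of_mul_log_le hb hn hc.one_sub_errorProb_mul_log_card₂_le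
  have hsum := rate_le_of_mul_log_le hb hn (hρ.one_sub_errorProb_mul_log_card_le hc)
  have hlog2 : 0 ≤ Real.logb b 2 / n :=
    div_nonneg (Real.logb_nonneg hb one_le_two) (Nat.cast_nonneg n)
  refine mem_dirtyMACOuterRegion_of_mem_Icc hb hρ.mem_Icc ?_ ?_ ?_
  · simpa only [Real.logb, mul_div_assoc] using h₁
  · simpa only [Real.logb, mul_div_assoc] using h₂
  · calc ((1 - c.errorProb Q) * Real.logb b k₁ - Real.logb b 2) / n +
          ((1 - c.errorProb Q) * Real.logb b k₂ - Real.logb b 2) / n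
        = ((1 - c.errorProb Q) * (Real.log k₁ + Real.log k₂) / Real.log b - Real.logb b 2) / n -
          Real.logb b 2 / n := by
          simp only [Real.logb]
          ring
      _ ≤ 1 / 2 * ((Real.log (1 + P₂ / interferenceVar P₁ Q ρ) + Real.log (residualVar P₁ ρ)) /
          Real.log b) := by linarith
      _ = 1 / 2 * Real.logb b (1 + P₂ / interferenceVar P₁ Q ρ) +
          1 / 2 * Real.logb b (residualVar P₁ ρ) := by
          simp only [Real.logb]
          ring

theorem DirtyMACAchievable.mem_outerRegion {R : ℝ × ℝ} (hR : DirtyMACAchievable b P₁ P₂ Q R)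
    (hb : 1 < b) : R ∈ dirtyMACOuterRegion b P₁ P₂ Q := by
  obtain ⟨-, -, k₁, k₂, c, hcode, herr⟩ := hR
  have hb0 : 0 < b := zero_lt_one.trans hb
  have hlogk : ∀ {x : ℝ} {k : ℕ}, b ^ x ≤ k → k ≠ 0 ∧ x ≤ Real.logb b k := fun {x k} h => by
    have hk : (0 : ℝ) < k := (Real.rpow_pos_of_pos hb0 x).trans_le h
    exact ⟨by exact_mod_cast hk.ne', (Real.le_logb_iff_rpow_le hb hk).2 h⟩
  have hrate : ∀ r : ℝ, Tendsto (fun n : ℕ => (1 - (c n).errorProb Q) * r - Real.logb b 2 / n)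
      atTop (𝓝 r) := fun r => by
    simpa using ((herr.const_sub 1).mul_const r).sub
      (tendsto_const_div_atTop_nhds_zero_nat (Real.logb b 2))
  refine isClosed_dirtyMACOuterRegion.mem_of_tendsto ((hrate R.1).prodMk_nhds (hrate R.2)) ?_
  filter_upwards [eventually_ne_atTop 0] with n hn
  obtain ⟨hR₁, hR₂, hc⟩ := hcode n
  obtain ⟨hk₁, hlog₁⟩ := hlogk hR₁
  obtain ⟨hk₂, hlog₂⟩ := hlogk hR₂
  have := NeZero.mk hk₁
  have := NeZero.mk hk₂
  have hcorrect : 0 ≤ 1 - (c n).errorProb Q := sub_nonneg.2 measureReal_le_one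
  have hle : ∀ {r y : ℝ}, n * r ≤ y → (1 - (c n).errorProb Q) * r - Real.logb b 2 / n ≤
      ((1 - (c n).errorProb Q) * y - Real.logb b 2) / n := fun {r y} h => by
    rw [sub_div, mul_div_assoc]
    gcongr
    rwa [le_div_iff₀' (by positivity)]
  exact isLowerSet_dirtyMACOuterRegion ⟨hle hlog₁, hle hlog₂⟩ (hc.rates_mem_outerRegion hb hn)

end OuterRegion

theorem theorem2 (b : ℝ) (hb : 1 < b) (P₁ P₂ Q : ℝ≥0) :
    dirtyMACCapacityRegion b P₁ P₂ Q ⊆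
      {R : ℝ × ℝ | ∃ ρ ∈ Set.Icc (-1 : ℝ) 0,
        R.1 ≤ 1 / 2 * Real.logb b (1 + P₁ * (1 - ρ ^ 2)) ∧
        R.2 ≤ 1 / 2 * Real.logb b (1 + P₂) ∧
        R.1 + R.2 ≤
          1 / 2 * Real.logb b (1 + P₂ / (1 + P₁ + Q + 2 * ρ * Real.sqrt (P₁ * Q))) +
            1 / 2 * Real.logb b (1 + P₁ * (1 - ρ ^ 2))} :=
  closure_minimal (fun _ hR => hR.mem_outerRegion hb) isClosed_dirtyMACOuterRegion
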